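/- Let $G$ be a compact (equivalently, closed) group of unitary $p\times p$ complex matrices, acting on $\mathbb{C}^p$ by matrix multiplication, and let $\eta$ be its Haar probability measure. Let $x_1,\dots,x_N\in\mathbb{C}^p$ and $\epsilon>0$. For $i,j\in[N]=\{1,\dots,N\}$ and $A,B\in G$ put $$W_{ij}(A,B)=e^{-\|Ax_i-Bx_j\|^2/\epsilon},\qquad D_{ii}=\sum_{j=1}^N\int_G W_{ij}(I,C)\,d\eta(C),\qquad P_{ij}(A,B)=\frac{W_{ij}(A,B)}{D_{ii}},$$ and let $P^t_{ij}$ be the $t$-step transition densities: $P^1=P$ and $P^t_{ij}(A,B)=\sum_{k=1}^N\int_G P^{t-1}_{ik}(A,C)\,P_{kj}(C,B)\,d\eta(C)$ for $t\ge 2$. Let $\{U^\ell\}_{\ell\in\mathcal I_G}$, with $U^\ell(A)$ of size $d_\ell\times d_\ell$, enumerate the (continuous, finite-dimensional) irreducible unitary representations of $G$, one for each equivalence class. For each $\ell$ let $\hat W^{(\ell)}$ be the $Nd_\ell\times Nd_\ell$ block matrix with $d_\ell\times d_\ell$ blocks $\hat W^\ell_{ij}=\int_G W_{ij}(I,A)\,\overline{U^\ell(A)}\,d\eta(A)$,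 let $D^{(\ell)}=\mathrm{diag}(D_{11}I_{d_\ell},\dots,D_{NN}I_{d_\ell})$, and let $K^{(\ell)}=I-(D^{(\ell)})^{-1}\hat W^{(\ell)}$. Let $\tilde v_{1,\ell},\dots,\tilde v_{Nd_\ell,\ell}\in\mathbb{C}^{Nd_\ell}$ be eigenvectors of $K^{(\ell)}$ with eigenvalues $\tilde\lambda_{1,\ell},\dots,\tilde\lambda_{Nd_\ell,\ell}$, normalized so that the vectors $(D^{(\ell)})^{1/2}\tilde v_{n,\ell}$, $1\le n\le Nd_\ell$, are orthonormal. Put $\lambda_{n,\ell}=1-\tilde\lambda_{n,\ell}$, write $e^i(v)\in\mathbb{C}^{d_\ell}$ for the $i$-th block of $v\in\mathbb{C}^{Nd_\ell}$, and define the $G$-equivariant diffusion map by $$\tilde\Phi_t(i,A)=\Bigl(\lambda_{n,\ell}^t\,\sqrt{d_\ell}\;\overline{U^\ell(A)}\,e^i(\tilde v_{n,\ell})\Bigr)_{\ell\in\mathcal I_G,\;1\le n\le Nd_\ell},$$ the sequence of complex numbers obtained by concatenating these $d_\ell$-dimensional vectors. Then for every integer $t\ge1$, all $i,j\in[N]$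 and all $A,B\in G$: the functions $P^t_{i,\cdot}(A,\cdot)$ and $P^t_{j,\cdot}(B,\cdot)$ are in $L^2([N]\times G)$, the sequences $\tilde\Phi_t(i,A)$ and $\tilde\Phi_t(j,B)$ are in $\ell^2$, and $$\bigl\|P^t_{i,\cdot}(A,\cdot)-P^t_{j,\cdot}(B,\cdot)\bigr\|^2_{\mathcal H,d\eta/D}:=\sum_{k=1}^N\int_G\bigl(P^t_{ik}(A,C)-P^t_{jk}(B,C)\bigr)^2\,\frac{d\eta(C)}{D_{kk}}=\bigl\|\tilde\Phi_t(i,A)-\tilde\Phi_t(j,B)\bigr\|^2_{\ell^2}.$$ -/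

import Mathlib

open MeasureTheory
open scoped Matrix ComplexConjugate

noncomputable section

namespace GDiffusion

/-! Groups of unitary `p × p` matrices, acting on `ℂ^p` by matrix multiplication. -/

section Representations

variable {p : ℕ} {G : Subgroup (Matrix.unitaryGroup (Fin p) ℂ)}

/-- A unitary representation is reducible if one unitary change of basis makes all its matrices
block diagonal, with two nonempty blocks indexed by `s` and its complement. (The order of the basis
vectors is immaterial, since permutation matrices are unitary.) -/
def IsReducible {n : ℕ} (U : G →* Matrix.unitaryGroup (Fin n) ℂ) : Prop :=
  ∃ (P : Matrix.unitaryGroup (Fin n) ℂ) (s : Set (Fin n)), s.Nonempty ∧ sᶜ.Nonempty ∧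
    ∀ (A : G) (a b : Fin n), ((a ∈ s ∧ b ∉ s) ∨ (a ∉ s ∧ b ∈ s)) →
      (P * U A * P⁻¹ : Matrix.unitaryGroup (Fin n) ℂ).1 a b = 0

/-- A (finite dimensional, continuous) irreducible unitary representation of `G`. -/
structure IsIUR {n : ℕ} (U : G →* Matrix.unitaryGroup (Fin n) ℂ) : Prop where
  dim_pos : 0 < n
  continuous : Continuous U
  irreducible : ¬ IsReducible U

/-- Unitary equivalence of two unitary representations: `Q U(A) = V(A) Q` with `Q` unitary. -/
def IsEquivalent {n m : ℕ} (U : G →* Matrix.unitaryGroup (Fin n) ℂ)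
    (V : G →* Matrix.unitaryGroup (Fin m) ℂ) : Prop :=
  ∃ Q : Matrix (Fin m) (Fin n) ℂ, Qᴴ * Q = 1 ∧ Q * Qᴴ = 1 ∧ ∀ A : G, Q * (U A).1 = (V A).1 * Q

/-- The family `U` enumerates the irreducible unitary representations of `G`: each one occurs,
up to equivalence, exactly once. -/
structure EnumeratesIURs {I : Type*} (d : I → ℕ)
    (U : ∀ ℓ : I, G →* Matrix.unitaryGroup (Fin (d ℓ)) ℂ) : Prop where
  isIUR : ∀ ℓ, IsIUR (U ℓ)
  inequivalent : ∀ ℓ ℓ', ℓ ≠ ℓ' → ¬ IsEquivalent (U ℓ) (U ℓ')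
  complete : ∀ (n : ℕ) (V : G →* Matrix.unitaryGroup (Fin n) ℂ), IsIUR V →
    ∃ ℓ, IsEquivalent V (U ℓ)

end Representations

section RandomWalk

variable {p : ℕ} {G : Subgroup (Matrix.unitaryGroup (Fin p) ℂ)} {N : ℕ}

/-- The action `A · y` of a matrix on a vector of `ℂ^p` with its Euclidean norm. -/
def act (A : G) (y : EuclideanSpace ℂ (Fin p)) : EuclideanSpace ℂ (Fin p) :=
  WithLp.toLp 2 (A.1.1 *ᵥ y.ofLp)

/-- `W_{ij}(A,B) = exp(-‖A x_i - B x_j‖² / ε)`. -/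
def kernelW (x : Fin N → EuclideanSpace ℂ (Fin p)) (ε : ℝ) (i j : Fin N) (A B : G) : ℝ :=
  Real.exp (-‖act A (x i) - act B (x j)‖ ^ 2 / ε)

variable [MeasurableSpace G]

/-- `D_{ii} = ∑_j ∫ W_{ij}(I,C) dη(C)`. -/
def degree (η : Measure G) (x : Fin N → EuclideanSpace ℂ (Fin p)) (ε : ℝ) (i : Fin N) : ℝ :=
  ∑ j, ∫ C, kernelW x ε i j (1 : G) C ∂η

/-- The one-step transition density `P_{ij}(A,B) = W_{ij}(A,B) / D_{ii}`. -/
def kernelP (η : Measure G) (x : Fin N → EuclideanSpace ℂ (Fin p)) (ε : ℝ)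
    (i j : Fin N) (A B : G) : ℝ :=
  kernelW x ε i j A B / degree η x ε i

/-- The `t`-step transition density `P^t_{ij}(A,B)` for `t ≥ 1` (the value at `t = 0`, where there
is no density, is a placeholder). -/
def stepKernel (η : Measure G) (x : Fin N → EuclideanSpace ℂ (Fin p)) (ε : ℝ) :
    ℕ → Fin N → Fin N → G → G → ℝ
  | 0 => fun _ _ _ _ => 0
  | 1 => kernelP η x ε
  | t + 2 => fun i j A B =>
      ∑ k, ∫ C, stepKernel η x ε (t + 1) i k A C * kernelP η x ε k j C B ∂η

/-- The squared norm `∑_k ∫ f_k(C)² dη(C) / D_{kk}` of a real function on `[N] × G`. -/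
def weightedNormSq (η : Measure G) (x : Fin N → EuclideanSpace ℂ (Fin p)) (ε : ℝ)
    (f : Fin N → G → ℝ) : ℝ :=
  ∑ k, ∫ C, f k C ^ 2 / degree η x ε k ∂η

end RandomWalk

section Spectral

variable {p : ℕ} {G : Subgroup (Matrix.unitaryGroup (Fin p) ℂ)} {N : ℕ}
  [MeasurableSpace G]

/-- The block matrix of Fourier coefficients, with blocks
`Ŵ_{ij} = ∫ W_{ij}(I,A) conj(U(A)) dη(A)`; the index `(i,a)` is row `a` of block row `i`. -/
def fourierMatrix (η : Measure G) (x : Fin N → EuclideanSpace ℂ (Fin p)) (ε : ℝ)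
    {d : ℕ} (U : G →* Matrix.unitaryGroup (Fin d) ℂ) :
    Matrix (Fin N × Fin d) (Fin N × Fin d) ℂ :=
  fun r s => ∫ A, (kernelW x ε r.1 s.1 (1 : G) A : ℂ) * conj ((U A).1 r.2 s.2) ∂η

/-- The block diagonal matrix `diag(D_{11} I_d, …, D_{NN} I_d)`. -/
def degreeMatrix (η : Measure G) (x : Fin N → EuclideanSpace ℂ (Fin p)) (ε : ℝ) (d : ℕ) :
    Matrix (Fin N × Fin d) (Fin N × Fin d) ℂ :=
  Matrix.diagonal fun r => (degree η x ε r.1 : ℂ)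

/-- The matrix `K = I - (diag(D_{ii} I_d))⁻¹ Ŵ`. -/
def matrixK (η : Measure G) (x : Fin N → EuclideanSpace ℂ (Fin p)) (ε : ℝ)
    {d : ℕ} (U : G →* Matrix.unitaryGroup (Fin d) ℂ) :
    Matrix (Fin N × Fin d) (Fin N × Fin d) ℂ :=
  1 - (degreeMatrix η x ε d)⁻¹ * fourierMatrix η x ε U

/-- The vectors `w n` and scalars `μ n` (`n = 1, …, N d`) are eigenvectors and eigenvalues of `K`,
normalized so that the vectors `diag(D_{ii} I_d)^{1/2} w n` are orthonormal in `ℂ^{N d}`. -/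
structure IsNormalizedEigensystem (η : Measure G) (x : Fin N → EuclideanSpace ℂ (Fin p)) (ε : ℝ)
    {d : ℕ} (U : G →* Matrix.unitaryGroup (Fin d) ℂ)
    (μ : Fin (N * d) → ℂ) (w : Fin (N * d) → Fin N × Fin d → ℂ) : Prop where
  eigen : ∀ n, matrixK η x ε U *ᵥ w n = μ n • w n
  orthonormal : Orthonormal ℂ fun n =>
    (WithLp.toLp 2 fun r => (√(degree η x ε r.1) : ℂ) * w n r :
      EuclideanSpace ℂ (Fin N × Fin d))

end Spectral

section DiffusionMap

variable {p : ℕ} {G : Subgroup (Matrix.unitaryGroup (Fin p) ℂ)} {N : ℕ}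

/-- The `i`-th block `e^i(v) ∈ ℂ^d` of a vector `v ∈ ℂ^{N d}`. -/
def block {d : ℕ} (i : Fin N) (v : Fin N × Fin d → ℂ) : Fin d → ℂ := fun a => v (i, a)

/-- The triples `(ℓ, n, m)` with `1 ≤ n ≤ N d_ℓ` and `1 ≤ m ≤ d_ℓ`. -/
abbrev MapIndex {I : Type*} (N : ℕ) (d : I → ℕ) : Type _ :=
  Σ ℓ : I, Fin (N * d ℓ) × Fin (d ℓ)

/-- The equivariant diffusion map: the coordinate of `Φ̃_t(i,A)` at `(ℓ,n,m)` is the `m`-th entry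
of `λ_{n,ℓ}^t √d_ℓ conj(U^ℓ(A)) e^i(ṽ_{n,ℓ})`, where `λ_{n,ℓ} = 1 - λ̃_{n,ℓ}`. -/
def diffusionMap {I : Type*} {d : I → ℕ} (U : ∀ ℓ : I, G →* Matrix.unitaryGroup (Fin (d ℓ)) ℂ)
    (lamTilde : ∀ ℓ : I, Fin (N * d ℓ) → ℂ)
    (vTilde : ∀ ℓ : I, Fin (N * d ℓ) → Fin N × Fin (d ℓ) → ℂ)
    (t : ℕ) (i : Fin N) (A : G) : MapIndex N d → ℂ :=
  fun r => (1 - lamTilde r.1 r.2.1) ^ t * (√(d r.1 : ℝ) : ℂ) *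
    (((U r.1 A).1.map conj) *ᵥ block i (vTilde r.1 r.2.1)) r.2.2

end DiffusionMap

end GDiffusion

end

noncomputable section

namespace GDiffusion

/-! ### Compactness of closed groups of unitary matrices -/

section Topology

variable {p : ℕ}

/-! The identity is Plancherel's formula on `G`, read in coordinates adapted to the walk. Since `G`
acts by isometries, `W_{ij}(A,B)` depends only on `A⁻¹B`. One step of the walk is therefore a
convolution on `G`, and on Fourier coefficients at `U^ℓ` it acts as right multiplication by the
matrix `T = D⁻¹Ŵ = I - K`. After `t` steps from `(i,A)` the coefficients form the row of blocks with
`conj(U^ℓ(A))` in position `i`, multiplied by `T^t`.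

The vectors `ṽ_n` satisfy `T ṽ_n = λ_n ṽ_n`, so pairing these coefficients with `ṽ_n` gives `λ_n^t
conj(U^ℓ(A)) e^i(ṽ_n)`, which is the diffusion map up to `√d_ℓ`. Because the `D^{1/2} ṽ_n` form an
orthonormal basis, the squared pairings sum over `n` to the squared coefficients weighted by
`1/D_kk`. Summing over `ℓ` with weights `d_ℓ` and applying Plancherel gives the weighted `L²` norm.
Everything is linear in the density, so the same computation applies to a difference of two
densities.

Plancherel's formula is derived from Schur's lemma (orthogonality of matrix entries),
Stone–Weierstrass (density of the entries of all representations) and complete reducibility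
(irreducible ones suffice). -/

instance secondCountableTopology_matrix :
    SecondCountableTopology (Matrix (Fin p) (Fin p) ℂ) :=
  inferInstanceAs (SecondCountableTopology (Fin p → Fin p → ℂ))

theorem compactSpace_unitaryGroup : CompactSpace (Matrix.unitaryGroup (Fin p) ℂ) := by
  refine isCompact_iff_compactSpace.mp ?_
  have hball : IsCompact (Set.univ.pi fun _ : Fin p => Set.univ.pi fun _ : Fin p =>
      Metric.closedBall (0 : ℂ) 1) :=
    isCompact_univ_pi fun _ => isCompact_univ_pi fun _ => isCompact_closedBall 0 1
  refine hball.of_isClosed_subset ?_ ?_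
  · have : (↑(Matrix.unitaryGroup (Fin p) ℂ) : Set (Matrix (Fin p) (Fin p) ℂ)) =
        {A | A * star A = 1} := by
      ext A
      exact Matrix.mem_unitaryGroup_iff
    rw [this]
    exact isClosed_eq (by fun_prop) continuous_const
  · intro A hA a _ b _
    simpa using entry_norm_bound_of_unitary hA a b

theorem compactSpace_of_isClosed {G : Subgroup (Matrix.unitaryGroup (Fin p) ℂ)}
    (hG : IsClosed (G : Set (Matrix.unitaryGroup (Fin p) ℂ))) : CompactSpace G :=
  haveI := compactSpace_unitaryGroup (p := p)
  isCompact_iff_compactSpace.mp hG.isCompact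

variable {G : Subgroup (Matrix.unitaryGroup (Fin p) ℂ)}

instance secondCountableTopology_subgroup : SecondCountableTopology G :=
  haveI : SecondCountableTopology (Matrix.unitaryGroup (Fin p) ℂ) :=
    Topology.IsEmbedding.subtypeVal.secondCountableTopology
  Topology.IsEmbedding.subtypeVal.secondCountableTopology

theorem continuous_entry {n : ℕ} {U : G →* Matrix.unitaryGroup (Fin n) ℂ} (hU : Continuous U)
    (a b : Fin n) : Continuous fun A : G => (U A).1 a b :=
  (continuous_subtype_val.comp hU).matrix_elem a b

theorem continuous_of_entries {n : ℕ} {U : G →* Matrix.unitaryGroup (Fin n) ℂ}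
    (hU : ∀ a b, Continuous fun A : G => (U A).1 a b) : Continuous U :=
  Continuous.subtype_mk (continuous_matrix hU) _

end Topology

/-! ### Schur's lemma for unitary representations -/

section Schur

variable {p : ℕ} {G : Subgroup (Matrix.unitaryGroup (Fin p) ℂ)} {n m : ℕ}
  {U : G →* Matrix.unitaryGroup (Fin n) ℂ} {V : G →* Matrix.unitaryGroup (Fin m) ℂ}

theorem coe_map_inv (U : G →* Matrix.unitaryGroup (Fin n) ℂ) (A : G) :
    (U A⁻¹).1 = (U A).1ᴴ := by
  rw [map_inv]; rfl

/-- In an eigenbasis of `H`, a matrix commuting with `H` has zero entries between different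
eigenvalues. If `H` had two eigenvalues, one eigenspace and its complement would block-diagonalize
every `U A` at once. -/
theorem IsIUR.scalar_of_isHermitian (hU : IsIUR U) {H : Matrix (Fin n) (Fin n) ℂ}
    (hH : H.IsHermitian) (hcomm : ∀ A : G, (U A).1 * H = H * (U A).1) :
    ∃ c : ℂ, H = c • (1 : Matrix (Fin n) (Fin n) ℂ) := by
  have hdiag := hH.conjStarAlgAut_star_eigenvectorUnitary
  set Q := hH.eigenvectorUnitary
  have hspec := hH.spectral_theorem
  rw [Unitary.conjStarAlgAut_apply] at hdiag hspec
  set lam := hH.eigenvalues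
  have hQ : Q.1 * star Q.1 = 1 := Unitary.coe_mul_star_self Q
  have key : ∀ (A : G) (a b : Fin n), lam a ≠ lam b → (star Q.1 * (U A).1 * Q.1) a b = 0 := by
    intro A a b hab
    have hc : (star Q.1 * (U A).1 * Q.1) * Matrix.diagonal (RCLike.ofReal ∘ lam) =
        Matrix.diagonal (RCLike.ofReal ∘ lam) * (star Q.1 * (U A).1 * Q.1) := by
      rw [← hdiag]
      simp only [Unitary.coe_star, star_star]
      calc _ = star Q.1 * (U A).1 * (Q.1 * star Q.1) * H * Q.1 := by simp only [mul_assoc]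
        _ = star Q.1 * ((U A).1 * H) * Q.1 := by rw [hQ]; simp only [mul_assoc, mul_one]
        _ = star Q.1 * H * (Q.1 * star Q.1) * (U A).1 * Q.1 := by
          rw [hcomm, hQ]; simp only [mul_assoc, mul_one]
        _ = _ := by simp only [mul_assoc]
    have := congrFun (congrFun hc a) b
    rw [Matrix.mul_diagonal, Matrix.diagonal_mul, mul_comm, ← sub_eq_zero, ← sub_mul,
      mul_eq_zero, sub_eq_zero] at this
    rcases this with h | h
    · exact absurd (Complex.ofReal_injective h).symm hab
    · exact h
  let a₀ : Fin n := ⟨0, hU.dim_pos⟩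
  have hconst : ∀ a, lam a = lam a₀ := by
    by_contra! hne
    obtain ⟨b, hb⟩ := hne
    refine hU.irreducible ⟨Q⁻¹, {a | lam a = lam a₀}, ⟨a₀, rfl⟩, ⟨b, hb⟩, ?_⟩
    intro A a c hac
    have : lam a ≠ lam c := by
      rcases hac with ⟨h1, h2⟩ | ⟨h1, h2⟩
      · exact fun h => h2 (h.symm.trans h1)
      · exact fun h => h1 (h.trans h2)
    have := key A a c this
    rw [inv_inv]
    exact this
  refine ⟨lam a₀, ?_⟩
  have : Matrix.diagonal (RCLike.ofReal ∘ lam) =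
      (lam a₀ : ℂ) • (1 : Matrix (Fin n) (Fin n) ℂ) := by
    rw [← Matrix.diagonal_one, ← Matrix.diagonal_smul]
    congr 1
    ext a
    simp [hconst a]
  rw [hspec, this]
  simp only [Matrix.mul_smul, Matrix.smul_mul, mul_one]
  exact congrArg _ hQ

/-- Take adjoints of the relation at `A⁻¹` and use unitarity. This makes `T * Tᴴ` and `Tᴴ * T`
commute with `U` and `V` respectively. -/
theorem conjTranspose_intertwines {T : Matrix (Fin n) (Fin m) ℂ}
    (hT : ∀ A : G, (U A).1 * T = T * (V A).1) (A : G) : (V A).1 * Tᴴ = Tᴴ * (U A).1 := by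
  have := congrArg Matrix.conjTranspose (hT A⁻¹)
  rw [Matrix.conjTranspose_mul, Matrix.conjTranspose_mul, coe_map_inv, coe_map_inv,
    Matrix.conjTranspose_conjTranspose, Matrix.conjTranspose_conjTranspose] at this
  exact this.symm

/-- **Schur's lemma** for a single irreducible representation. -/
theorem IsIUR.scalar_of_commute (hU : IsIUR U) {T : Matrix (Fin n) (Fin n) ℂ}
    (hT : ∀ A : G, (U A).1 * T = T * (U A).1) :
    ∃ c : ℂ, T = c • (1 : Matrix (Fin n) (Fin n) ℂ) := by
  have hT' := conjTranspose_intertwines hT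
  -- Both `T + Tᴴ` and `i(T - Tᴴ)` are Hermitian and commute with `U`, hence are scalars `c` and
  -- `c'`; solving for `T` gives `(c - i c')/2`.
  obtain ⟨c, hc⟩ := hU.scalar_of_isHermitian (Matrix.isHermitian_add_transpose_self T)
    fun A => by rw [mul_add, add_mul, hT, hT']
  obtain ⟨c', hc'⟩ := hU.scalar_of_isHermitian (H := Complex.I • (T - Tᴴ))
    (by
      ext a b
      simp [Matrix.conjTranspose_apply]
      ring)
    fun A => by rw [Matrix.mul_smul, Matrix.smul_mul, mul_sub, sub_mul, hT, hT']
  refine ⟨(c - Complex.I * c') / 2, ?_⟩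
  have h2 : T - Tᴴ = (-Complex.I * c') • (1 : Matrix (Fin n) (Fin n) ℂ) := by
    rw [mul_smul, ← hc', smul_smul]
    simp
  have h3 : T = (2⁻¹ : ℂ) • ((T + Tᴴ) + (T - Tᴴ)) := by
    rw [add_add_sub_cancel, ← two_smul ℂ T, smul_smul]
    simp
  rw [h3, hc, h2, ← add_smul, smul_smul]
  congr 1
  ring

open scoped ComplexOrder in
/-- **Schur's lemma** for two inequivalent irreducible representations. -/
theorem IsIUR.eq_zero_of_intertwines (hU : IsIUR U) (hV : IsIUR V) (hUV : ¬ IsEquivalent U V)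
    {T : Matrix (Fin n) (Fin m) ℂ} (hT : ∀ A : G, (U A).1 * T = T * (V A).1) : T = 0 := by
  by_contra hne
  have hT' := conjTranspose_intertwines hT
  obtain ⟨c, hc⟩ := hU.scalar_of_commute (T := T * Tᴴ)
    fun A => by rw [← Matrix.mul_assoc, hT, Matrix.mul_assoc, hT', Matrix.mul_assoc]
  obtain ⟨c', hc'⟩ := hV.scalar_of_commute (T := Tᴴ * T)
    fun A => by rw [← Matrix.mul_assoc, hT', Matrix.mul_assoc, hT, Matrix.mul_assoc]
  have hcc : c = c' := by
    have h : c • T = c' • T := by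
      calc c • T = (T * Tᴴ) * T := by rw [hc, Matrix.smul_mul, Matrix.one_mul]
        _ = T * (Tᴴ * T) := Matrix.mul_assoc _ _ _
        _ = c' • T := by rw [hc', Matrix.mul_smul, Matrix.mul_one]
    exact smul_left_injective ℂ hne h
  subst hcc
  let a₀ : Fin n := ⟨0, hU.dim_pos⟩
  -- A diagonal entry of `T * Tᴴ = c • 1` shows that `c` is real and nonnegative; it is nonzero
  -- because `T ≠ 0`.
  have hc_eq : c = ((∑ b, ‖T a₀ b‖ ^ 2 : ℝ) : ℂ) := by
    have := congrFun (congrFun hc a₀) a₀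
    simp only [Matrix.mul_apply, Matrix.conjTranspose_apply, Matrix.smul_apply, Matrix.one_apply_eq,
      smul_eq_mul, mul_one] at this
    rw [← this]
    push_cast
    refine Finset.sum_congr rfl fun b _ => ?_
    exact Complex.mul_conj' _
  set r : ℝ := ∑ b, ‖T a₀ b‖ ^ 2
  have hr0 : 0 ≤ r := by positivity
  have hr : r ≠ 0 := by
    intro h
    rw [h] at hc_eq
    rw [hc_eq, Complex.ofReal_zero, zero_smul, Matrix.self_mul_conjTranspose_eq_zero] at hc
    exact hne hc
  have hs : (((√r)⁻¹ : ℝ) : ℂ) * (((√r)⁻¹ : ℝ) : ℂ) * c = 1 := by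
    rw [hc_eq, ← Complex.ofReal_mul, ← Complex.ofReal_mul, ← mul_inv, Real.mul_self_sqrt hr0,
      inv_mul_cancel₀ hr, Complex.ofReal_one]
  -- Since `T * Tᴴ` and `Tᴴ * T` are both `r • 1`, dividing `Tᴴ` by `√r` makes it a unitary
  -- equivalence.
  refine hUV ⟨(((√r)⁻¹ : ℝ) : ℂ) • Tᴴ, ?_, ?_, fun A => ?_⟩
  · simp only [Matrix.conjTranspose_smul, Matrix.conjTranspose_conjTranspose, Matrix.smul_mul,
      Matrix.mul_smul, hc, smul_smul]
    rw [show star (((√r)⁻¹ : ℝ) : ℂ) = (((√r)⁻¹ : ℝ) : ℂ) from Complex.conj_ofReal _,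
      ← mul_assoc, hs, one_smul]
  · simp only [Matrix.conjTranspose_smul, Matrix.conjTranspose_conjTranspose, Matrix.smul_mul,
      Matrix.mul_smul, hc', smul_smul]
    rw [show star (((√r)⁻¹ : ℝ) : ℂ) = (((√r)⁻¹ : ℝ) : ℂ) from Complex.conj_ofReal _,
      ← mul_assoc, hs, one_smul]
  · rw [Matrix.smul_mul, Matrix.mul_smul, hT']

end Schur

/-! ### Density of matrix entries and complete reducibility -/

section Representative

variable {p : ℕ} {G : Subgroup (Matrix.unitaryGroup (Fin p) ℂ)}

/-- A multiplicative family of unitary matrices, as a unitary representation on `ℂ^n`. -/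
def repOfMatrix {κ : Type*} [Fintype κ] [DecidableEq κ] {n : ℕ} (e : κ ≃ Fin n)
    (M : G → Matrix κ κ ℂ) (hM1 : M 1 = 1) (hMmul : ∀ A B, M (A * B) = M A * M B)
    (hMstar : ∀ A, M A * (M A)ᴴ = 1) : G →* Matrix.unitaryGroup (Fin n) ℂ where
  toFun A := ⟨(M A).submatrix e.symm e.symm, by
    rw [Matrix.mem_unitaryGroup_iff, Matrix.star_eq_conjTranspose, Matrix.conjTranspose_submatrix,
      Matrix.submatrix_mul_equiv, hMstar, Matrix.submatrix_one_equiv]⟩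
  map_one' := Subtype.ext (by simp [hM1])
  map_mul' A B := Subtype.ext (by simp [hMmul, Matrix.submatrix_mul_equiv])

theorem repOfMatrix_apply {κ : Type*} [Fintype κ] [DecidableEq κ] {n : ℕ} (e : κ ≃ Fin n)
    {M : G → Matrix κ κ ℂ} (hM1 : M 1 = 1) (hMmul : ∀ A B, M (A * B) = M A * M B)
    (hMstar : ∀ A, M A * (M A)ᴴ = 1) (A : G) (a b : κ) :
    (repOfMatrix e M hM1 hMmul hMstar A).1 (e a) (e b) = M A a b := by
  simp [repOfMatrix]

theorem continuous_repOfMatrix {κ : Type*} [Fintype κ] [DecidableEq κ] {n : ℕ} (e : κ ≃ Fin n)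
    {M : G → Matrix κ κ ℂ} (hM1 : M 1 = 1) (hMmul : ∀ A B, M (A * B) = M A * M B)
    (hMstar : ∀ A, M A * (M A)ᴴ = 1) (hM : ∀ a b, Continuous fun A => M A a b) :
    Continuous (repOfMatrix e M hM1 hMmul hMstar) :=
  continuous_of_entries fun a b => hM (e.symm a) (e.symm b)

theorem map_mul_conjTranspose {n : ℕ} (U : G →* Matrix.unitaryGroup (Fin n) ℂ) (A : G) :
    (U A).1 * (U A).1ᴴ = 1 :=
  Matrix.mem_unitaryGroup_iff.mp (U A).2

/-- The functions on `G` that are an entry of some continuous unitary representation. -/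
def representativeFunctions (G : Subgroup (Matrix.unitaryGroup (Fin p) ℂ)) : Set C(G, ℂ) :=
  {f | ∃ (n : ℕ) (V : G →* Matrix.unitaryGroup (Fin n) ℂ) (a b : Fin n),
    Continuous V ∧ ∀ A, f A = (V A).1 a b}

theorem mem_representativeFunctions_of_matrix {κ : Type*} [Fintype κ] [DecidableEq κ]
    {M : G → Matrix κ κ ℂ} (hM1 : M 1 = 1) (hMmul : ∀ A B, M (A * B) = M A * M B)
    (hMstar : ∀ A, M A * (M A)ᴴ = 1) (hM : ∀ a b, Continuous fun A => M A a b)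
    {f : C(G, ℂ)} {a b : κ} (hf : ∀ A, f A = M A a b) : f ∈ representativeFunctions G :=
  ⟨_, repOfMatrix (Fintype.equivFin κ) M hM1 hMmul hMstar, _, _,
    continuous_repOfMatrix _ hM1 hMmul hMstar hM,
    fun A => (hf A).trans (repOfMatrix_apply _ hM1 hMmul hMstar A a b).symm⟩

theorem one_mem_representativeFunctions : (1 : C(G, ℂ)) ∈ representativeFunctions G :=
  mem_representativeFunctions_of_matrix (κ := Unit) (M := fun _ => 1) rfl (by simp) (by simp)
    (fun _ _ => continuous_const) (a := ()) (b := ()) (by simp)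

/-- Products of entries are the entries of the tensor product representation. -/
theorem mul_mem_representativeFunctions {f g : C(G, ℂ)} (hf : f ∈ representativeFunctions G)
    (hg : g ∈ representativeFunctions G) : f * g ∈ representativeFunctions G := by
  obtain ⟨n, U, a, b, hU, hf⟩ := hf
  obtain ⟨m, V, c, d, hV, hg⟩ := hg
  refine mem_representativeFunctions_of_matrix
    (M := fun A => Matrix.kroneckerMap (· * ·) (U A).1 (V A).1) ?_ ?_ ?_ ?_
    (a := (a, c)) (b := (b, d)) ?_
  · simp
  · intro A B
    simp only [map_mul, Submonoid.coe_mul]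
    exact Matrix.mul_kronecker_mul _ _ _ _
  · intro A
    have h := Matrix.conjTranspose_kronecker (U A).1 (V A).1
    have h' := Matrix.mul_kronecker_mul (U A).1 (U A).1ᴴ (V A).1 (V A).1ᴴ
    rw [map_mul_conjTranspose, map_mul_conjTranspose, Matrix.one_kronecker_one] at h'
    exact (congrArg _ h).trans h'.symm
  · exact fun r s => (continuous_entry hU r.1 s.1).mul (continuous_entry hV r.2 s.2)
  · intro A
    simp [hf, hg]

theorem star_mem_representativeFunctions {f : C(G, ℂ)} (hf : f ∈ representativeFunctions G) :
    star f ∈ representativeFunctions G := by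
  obtain ⟨n, U, a, b, hU, hf⟩ := hf
  refine mem_representativeFunctions_of_matrix (M := fun A => (U A).1.map (starRingEnd ℂ))
    ?_ ?_ ?_ ?_ (a := a) (b := b) ?_
  · simp
  · intro A B
    simp only [map_mul, Submonoid.coe_mul]
    exact Matrix.map_mul
  · intro A
    have h : ((U A).1.map (starRingEnd ℂ))ᴴ = (U A).1ᴴ.map (starRingEnd ℂ) := rfl
    rw [h, ← Matrix.map_mul, map_mul_conjTranspose]
    simp
  · exact fun a b => Complex.continuous_conj.comp (continuous_entry hU a b)
  · intro A
    simp [hf]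

/-- Stone–Weierstrass. The set is closed under products and conjugation, so its linear span is
already the star subalgebra it generates. The entries of the defining representation separate
points. -/
theorem span_representativeFunctions_dense [CompactSpace G] :
    Dense (Submodule.span ℂ (representativeFunctions G) : Set C(G, ℂ)) := by
  have hstar : representativeFunctions G ∪ star (representativeFunctions G) =
      representativeFunctions G :=
    Set.union_eq_left.mpr fun f hf => by simpa using star_mem_representativeFunctions hf
  have hclosure : (Submonoid.closure (representativeFunctions G) : Set C(G, ℂ)) =
      representativeFunctions G :=
    congrArg SetLike.coe (Submonoid.closure_eq
      { carrier := representativeFunctions G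
        one_mem' := one_mem_representativeFunctions
        mul_mem' := mul_mem_representativeFunctions })
  have hadjoin : (StarAlgebra.adjoin ℂ (representativeFunctions G) : Set C(G, ℂ)) =
      Submodule.span ℂ (representativeFunctions G) := by
    have h := Algebra.adjoin_eq_span ℂ
      (representativeFunctions G ∪ star (representativeFunctions G))
    rw [hstar, hclosure] at h
    rw [← h, ← StarSubalgebra.coe_toSubalgebra, StarAlgebra.adjoin_toSubalgebra, hstar]
    rfl
  have htop := ContinuousMap.starSubalgebra_topologicalClosure_eq_top_of_separatesPoints
    (StarAlgebra.adjoin ℂ (representativeFunctions G)) ?_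
  · rw [← hadjoin]
    have := congrArg (SetLike.coe) htop
    rw [StarSubalgebra.topologicalClosure_coe] at this
    exact dense_iff_closure_eq.mpr this
  · intro A B hAB
    have hne : ∃ a b, A.1.1 a b ≠ B.1.1 a b := by
      by_contra! h
      exact hAB (Subtype.ext (Subtype.ext (Matrix.ext h)))
    obtain ⟨a, b, hab⟩ := hne
    have hc : Continuous G.subtype := continuous_subtype_val
    exact ⟨_, ⟨⟨fun A => A.1.1 a b, continuous_entry hc a b⟩,
      StarAlgebra.subset_adjoin ℂ _ ⟨p, G.subtype, a, b, hc, fun _ => rfl⟩, rfl⟩, hab⟩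

theorem submatrix_mul_of_block {n : ℕ} {s : Set (Fin n)} [DecidablePred (· ∈ s)]
    {X : Matrix (Fin n) (Fin n) ℂ} (Y : Matrix (Fin n) (Fin n) ℂ)
    (hX : ∀ a ∈ s, ∀ b ∉ s, X a b = 0) :
    (X * Y).submatrix (Subtype.val : s → Fin n) (Subtype.val : s → Fin n) =
      X.submatrix Subtype.val Subtype.val * Y.submatrix Subtype.val Subtype.val := by
  ext a c
  simp only [Matrix.submatrix_apply, Matrix.mul_apply]
  rw [← Fintype.sum_subtype_add_sum_subtype (· ∈ s) fun b => X a b * Y b c]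
  simp only [add_eq_left]
  exact Finset.sum_eq_zero fun b _ => by rw [hX a a.2 b b.2, zero_mul]

variable {I : Type*} {d : I → ℕ} {U : ∀ ℓ : I, G →* Matrix.unitaryGroup (Fin (d ℓ)) ℂ}

/-- The linear span of the entries of a family of representations. -/
def entrySpan (U : ∀ ℓ : I, G →* Matrix.unitaryGroup (Fin (d ℓ)) ℂ) : Submodule ℂ (G → ℂ) :=
  Submodule.span ℂ {f | ∃ ℓ a b, f = fun A => (U ℓ A).1 a b}

/-- The block indexed by `s` is itself a unitary representation, of smaller dimension because `sᶜ`
is nonempty, so `hlt` applies. Vanishing of the entries from `s` to `sᶜ` is enough, both for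
multiplicativity and for unitarity. -/
theorem entry_mem_entrySpan_of_blocks {n : ℕ} (V : G →* Matrix.unitaryGroup (Fin n) ℂ)
    (hV : Continuous V)
    (hlt : ∀ m < n, ∀ W : G →* Matrix.unitaryGroup (Fin m) ℂ, Continuous W →
      ∀ a b, (fun A => (W A).1 a b) ∈ entrySpan U)
    (P : Matrix.unitaryGroup (Fin n) ℂ) (s : Set (Fin n)) (hs : sᶜ.Nonempty)
    (hP : ∀ (A : G), ∀ a ∈ s, ∀ b ∉ s,
      (P * V A * P⁻¹ : Matrix.unitaryGroup (Fin n) ℂ).1 a b = 0)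
    {a b : Fin n} (ha : a ∈ s) (hb : b ∈ s) :
    (fun A => (P * V A * P⁻¹ : Matrix.unitaryGroup (Fin n) ℂ).1 a b) ∈ entrySpan U := by
  classical
  let X : G → Matrix (Fin n) (Fin n) ℂ :=
    fun A => (P * V A * P⁻¹ : Matrix.unitaryGroup (Fin n) ℂ).1
  have hX1 : X 1 = 1 := by simp [X]
  have hXmul : ∀ A B, X (A * B) = X A * X B := fun A B => by
    have : P * V (A * B) * P⁻¹ = (P * V A * P⁻¹) * (P * V B * P⁻¹) := by
      rw [map_mul]; group
    simp only [X, this]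
    rfl
  have hXstar : ∀ A, X A * (X A)ᴴ = 1 := fun A =>
    Matrix.mem_unitaryGroup_iff.mp (P * V A * P⁻¹ : Matrix.unitaryGroup (Fin n) ℂ).2
  have hXcont : ∀ a b, Continuous fun A => X A a b := fun a b => by
    have : Continuous fun A => P * V A * P⁻¹ := by fun_prop
    exact (continuous_subtype_val.comp this).matrix_elem a b
  let M : G → Matrix s s ℂ := fun A => (X A).submatrix Subtype.val Subtype.val
  have hM1 : M 1 = 1 := by
    simp only [M, hX1]
    exact Matrix.submatrix_one _ Subtype.val_injective
  have hMmul : ∀ A B, M (A * B) = M A * M B := fun A B => by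
    simp only [M, hXmul]
    exact submatrix_mul_of_block _ (hP A)
  have hMstar : ∀ A, M A * (M A)ᴴ = 1 := fun A => by
    simp only [M, Matrix.conjTranspose_submatrix]
    rw [← submatrix_mul_of_block _ (hP A), hXstar]
    exact Matrix.submatrix_one _ Subtype.val_injective
  have hcard : Fintype.card s < n := by
    obtain ⟨c, hc⟩ := hs
    simpa using Fintype.card_subtype_lt (p := (· ∈ s)) hc
  have := hlt _ hcard (repOfMatrix (Fintype.equivFin s) M hM1 hMmul hMstar)
    (continuous_repOfMatrix _ hM1 hMmul hMstar fun a b => hXcont a b)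
    (Fintype.equivFin s ⟨a, ha⟩) (Fintype.equivFin s ⟨b, hb⟩)
  simp only [repOfMatrix_apply] at this
  exact this

theorem entry_mem_entrySpan_of_eq {n m : ℕ} {V : G → Matrix (Fin n) (Fin n) ℂ}
    (L : Matrix (Fin n) (Fin m) ℂ) (R : Matrix (Fin m) (Fin n) ℂ)
    (X : G → Matrix (Fin m) (Fin m) ℂ) (hX : ∀ c e, (fun A => X A c e) ∈ entrySpan U)
    (hVX : ∀ A, V A = L * X A * R) (a b : Fin n) : (fun A => V A a b) ∈ entrySpan U := by
  have : (fun A => V A a b) = ∑ e, ∑ c, (L a c * R e b) • fun A => X A c e := by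
    ext A
    simp only [hVX, Matrix.mul_apply, Finset.sum_mul, Finset.sum_apply, Pi.smul_apply,
      smul_eq_mul]
    exact Finset.sum_congr rfl fun e _ => Finset.sum_congr rfl fun c _ => by ring
  rw [this]
  exact Submodule.sum_mem _ fun e _ => Submodule.sum_mem _ fun c _ =>
    Submodule.smul_mem _ _ (hX c e)

/-- Complete reducibility: the entries of any continuous unitary representation are linear
combinations of the entries of the irreducible ones. -/
theorem EnumeratesIURs.entry_mem_entrySpan (hU : EnumeratesIURs d U) (n : ℕ)
    (V : G →* Matrix.unitaryGroup (Fin n) ℂ) (hV : Continuous V) (a b : Fin n) :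
    (fun A => (V A).1 a b) ∈ entrySpan U := by
  induction n using Nat.strong_induction_on with
  | _ n ih =>
  by_cases hred : IsReducible V
  · obtain ⟨P, s, hs, hsc, hP⟩ := hred
    refine entry_mem_entrySpan_of_eq (P⁻¹).1 P.1
      (fun A => (P * V A * P⁻¹ : Matrix.unitaryGroup (Fin n) ℂ).1) (fun c e => ?_) (fun A => ?_) a b
    · by_cases hc : c ∈ s <;> by_cases he : e ∈ s
      · exact entry_mem_entrySpan_of_blocks V hV
          ih P s hsc
          (fun A a ha b hb => hP A a b (Or.inl ⟨ha, hb⟩)) hc he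
      · simp only [hP _ c e (Or.inl ⟨hc, he⟩)]
        exact zero_mem _
      · simp only [hP _ c e (Or.inr ⟨hc, he⟩)]
        exact zero_mem _
      · exact entry_mem_entrySpan_of_blocks V hV
          ih P sᶜ (by simpa using hs)
          (fun A a ha b hb => hP A a b (Or.inr ⟨ha, not_not.mp hb⟩)) hc he
    · have : V A = P⁻¹ * (P * V A * P⁻¹) * P := by group
      exact congrArg Subtype.val this
  -- The index `a : Fin n` itself witnesses that the dimension is positive.
  · obtain ⟨ℓ, Q, hQ, -, hint⟩ := hU.complete n V ⟨a.pos, hV, hred⟩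
    refine entry_mem_entrySpan_of_eq Qᴴ Q (fun A => (U ℓ A).1)
      (fun c e => Submodule.subset_span ⟨ℓ, c, e, rfl⟩) (fun A => ?_) a b
    rw [Matrix.mul_assoc, ← hint, ← Matrix.mul_assoc, hQ, Matrix.one_mul]

/-- The normalized entry `√d_ℓ U^ℓ_{ab}` as a continuous function. -/
def EnumeratesIURs.normalizedEntry (hU : EnumeratesIURs d U) (r : Σ ℓ : I, Fin (d ℓ) × Fin (d ℓ)) :
    C(G, ℂ) :=
  ⟨fun A => (√(d r.1 : ℝ) : ℂ) * (U r.1 A).1 r.2.1 r.2.2,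
    continuous_const.mul (continuous_entry (hU.isIUR r.1).continuous _ _)⟩

theorem EnumeratesIURs.mem_span_normalizedEntry (hU : EnumeratesIURs d U) {f : C(G, ℂ)}
    (hf : f ∈ representativeFunctions G) :
    f ∈ Submodule.span ℂ (Set.range hU.normalizedEntry) := by
  let coe : C(G, ℂ) →ₗ[ℂ] (G → ℂ) := ContinuousMap.coeFnLinearMap ℂ
  have hcoe : Function.Injective coe := DFunLike.coe_injective
  obtain ⟨n, V, a, b, hV, hfV⟩ := hf
  have h1 : coe f ∈ entrySpan U := by
    have : coe f = fun A => (V A).1 a b := funext hfV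
    rw [this]
    exact hU.entry_mem_entrySpan n V hV a b
  have h2 : entrySpan U ≤ (Submodule.span ℂ (Set.range hU.normalizedEntry)).map coe := by
    refine Submodule.span_le.mpr ?_
    rintro _ ⟨ℓ, a, b, rfl⟩
    have hd : (√(d ℓ : ℝ) : ℂ) ≠ 0 := by
      have := (hU.isIUR ℓ).dim_pos
      exact Complex.ofReal_ne_zero.mpr (by positivity)
    refine ⟨(√(d ℓ : ℝ) : ℂ)⁻¹ • hU.normalizedEntry ⟨ℓ, a, b⟩,
      Submodule.smul_mem _ _ (Submodule.subset_span ⟨_, rfl⟩), ?_⟩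
    ext A
    simp [coe, normalizedEntry, hd]
  obtain ⟨g, hg, hgf⟩ := h2 h1
  exact hcoe hgf ▸ hg

end Representative

/-! ### Schur orthogonality, Peter–Weyl and Plancherel -/

section Orthogonality

variable {p : ℕ} {G : Subgroup (Matrix.unitaryGroup (Fin p) ℂ)} [CompactSpace G]
  [MeasurableSpace G] [BorelSpace G] (η : Measure G) [η.IsHaarMeasure]

theorem integrable_of_continuous {E : Type*} [NormedAddCommGroup E] {f : G → E}
    (hf : Continuous f) : Integrable f η :=
  hf.integrable_of_hasCompactSupport (HasCompactSupport.of_compactSpace f)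

/-- The matrix is the average over the group of `U(A) E V(A)ᴴ`, with `E` the matrix unit at `(b,
e)`; left invariance of `η` makes it an intertwiner. -/
theorem integral_entry_intertwines {n m : ℕ} {U : G →* Matrix.unitaryGroup (Fin n) ℂ}
    {V : G →* Matrix.unitaryGroup (Fin m) ℂ} (hU : Continuous U) (hV : Continuous V)
    (b : Fin n) (e : Fin m) (B : G) :
    (U B).1 * Matrix.of (fun a c => ∫ A, (U A).1 a b * conj ((V A).1 c e) ∂η) =
      Matrix.of (fun a c => ∫ A, (U A).1 a b * conj ((V A).1 c e) ∂η) * (V B).1 := by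
  have hint : ∀ a c, Integrable (fun A => (U A).1 a b * conj ((V A).1 c e)) η := fun a c =>
    integrable_of_continuous η ((continuous_entry hU a b).mul
      (Complex.continuous_conj.comp (continuous_entry hV c e)))
  ext a c
  simp only [Matrix.mul_apply, Matrix.of_apply]
  -- Writing `A` as `B⁻¹ * (B * A)` turns the integrand into a function of `B * A`, ready for
  -- translation.
  calc ∑ k, (U B).1 a k * ∫ A, (U A).1 k b * conj ((V A).1 c e) ∂η
      = ∫ A, (U (B * A)).1 a b * conj ((V (B⁻¹ * (B * A))).1 c e) ∂η := by
        simp only [← integral_const_mul]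
        rw [← integral_finsetSum _ fun k _ => (hint k c).const_mul _]
        congr 1
        ext A
        rw [inv_mul_cancel_left, map_mul, Submonoid.coe_mul, Matrix.mul_apply, Finset.sum_mul]
        exact Finset.sum_congr rfl fun k _ => by ring
    _ = ∫ A, (U A).1 a b * conj ((V (B⁻¹ * A)).1 c e) ∂η :=
        integral_mul_left_eq_self (fun A => (U A).1 a b * conj ((V (B⁻¹ * A)).1 c e)) B
    _ = ∑ k, (∫ A, (U A).1 a b * conj ((V A).1 k e) ∂η) * (V B).1 k c := by
        simp only [← integral_mul_const]
        rw [← integral_finsetSum _ fun k _ => (hint a k).mul_const _]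
        congr 1
        ext A
        rw [map_mul, Submonoid.coe_mul, Matrix.mul_apply, map_sum, Finset.mul_sum]
        refine Finset.sum_congr rfl fun k _ => ?_
        rw [map_mul, coe_map_inv, Matrix.conjTranspose_apply, RCLike.star_def, Complex.conj_conj]
        ring

theorem integral_entry_mul_conj_entry_of_not_isEquivalent {n m : ℕ}
    {U : G →* Matrix.unitaryGroup (Fin n) ℂ} {V : G →* Matrix.unitaryGroup (Fin m) ℂ}
    (hU : IsIUR U) (hV : IsIUR V) (hUV : ¬ IsEquivalent U V) (a b : Fin n) (c e : Fin m) :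
    ∫ A, (U A).1 a b * conj ((V A).1 c e) ∂η = 0 :=
  congrFun (congrFun (hU.eq_zero_of_intertwines hV hUV
    (integral_entry_intertwines η hU.continuous hV.continuous b e)) a) c

theorem integral_entry_mul_conj_entry_self [IsProbabilityMeasure η] {n : ℕ}
    {U : G →* Matrix.unitaryGroup (Fin n) ℂ} (hU : IsIUR U) (a b c e : Fin n) :
    (n : ℂ) * ∫ A, (U A).1 a b * conj ((U A).1 c e) ∂η = if a = c ∧ b = e then 1 else 0 := by
  obtain ⟨z, hz⟩ := hU.scalar_of_commute
    (integral_entry_intertwines η hU.continuous hU.continuous b e)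
  have hentry : ∀ a c, ∫ A, (U A).1 a b * conj ((U A).1 c e) ∂η = if a = c then z else 0 := by
    intro a c
    have := congrFun (congrFun hz a) c
    simpa [Matrix.one_apply] using this
  -- The trace determines the scalar `z`: summing over `a` reassembles an entry of `(U A)ᴴ * U A =
  -- 1`.
  have htrace : (n : ℂ) * z = if b = e then 1 else 0 := by
    calc (n : ℂ) * z = ∑ a, ∫ A, (U A).1 a b * conj ((U A).1 a e) ∂η := by simp [hentry]
      _ = ∫ A, ((U A).1ᴴ * (U A).1) e b ∂η := by
        have hint : ∀ a, Integrable (fun A => (U A).1 a b * conj ((U A).1 a e)) η := fun a =>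
          integrable_of_continuous η ((continuous_entry hU.continuous a b).mul
            (Complex.continuous_conj.comp (continuous_entry hU.continuous a e)))
        rw [← integral_finsetSum _ fun a _ => hint a]
        congr 1
        ext A
        rw [Matrix.mul_apply]
        exact Finset.sum_congr rfl fun a _ => mul_comm _ _
      _ = if b = e then 1 else 0 := by
        have h : ∀ A, (U A).1ᴴ * (U A).1 = 1 := fun A => Matrix.mem_unitaryGroup_iff'.mp (U A).2
        simp only [h, integral_const, probReal_univ, one_smul, Matrix.one_apply, eq_comm]
  rw [hentry]
  by_cases hac : a = c <;> simp [hac, htrace]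

variable {I : Type*} {d : I → ℕ} {U : ∀ ℓ : I, G →* Matrix.unitaryGroup (Fin (d ℓ)) ℂ}

variable [IsProbabilityMeasure η]

/-- **Schur orthogonality relations**. -/
theorem EnumeratesIURs.orthonormal (hU : EnumeratesIURs d U) :
    Orthonormal ℂ fun r => ContinuousMap.toLp 2 η ℂ (hU.normalizedEntry r) := by
  classical
  rw [orthonormal_iff_ite]
  rintro ⟨ℓ, a, b⟩ ⟨ℓ', c, e⟩
  rw [ContinuousMap.inner_toLp]
  have hpull : ∫ A, hU.normalizedEntry ⟨ℓ', c, e⟩ A * conj (hU.normalizedEntry ⟨ℓ, a, b⟩ A) ∂η =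
      (√(d ℓ' : ℝ) : ℂ) * (√(d ℓ : ℝ) : ℂ) *
        ∫ A, (U ℓ' A).1 c e * conj ((U ℓ A).1 a b) ∂η := by
    rw [← integral_const_mul]
    congr 1
    ext A
    simp only [normalizedEntry, ContinuousMap.coe_mk, map_mul, Complex.conj_ofReal]
    ring
  rw [hpull]
  by_cases hℓ : ℓ = ℓ'
  · subst hℓ
    rw [← Complex.ofReal_mul, Real.mul_self_sqrt (Nat.cast_nonneg _), Complex.ofReal_natCast,
      integral_entry_mul_conj_entry_self η (hU.isIUR ℓ)]
    simp [Prod.ext_iff, eq_comm]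
  · rw [integral_entry_mul_conj_entry_of_not_isEquivalent η (hU.isIUR ℓ') (hU.isIUR ℓ)
      (hU.inequivalent _ _ (Ne.symm hℓ)), mul_zero, if_neg]
    intro h
    exact hℓ (congrArg Sigma.fst h)

/-- **Peter–Weyl theorem**: the normalized entries span a dense subspace of `L²(G)`. -/
theorem EnumeratesIURs.span_dense (hU : EnumeratesIURs d U) :
    ⊤ ≤ (Submodule.span ℂ (Set.range fun r =>
      ContinuousMap.toLp 2 η ℂ (hU.normalizedEntry r))).topologicalClosure := by
  have hdense := (ContinuousMap.toLp_denseRange (p := 2) ℂ η ℂ (by simp)).dense_image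
    (ContinuousLinearMap.continuous _) (span_representativeFunctions_dense (G := G))
  rw [top_le_iff, ← Submodule.dense_iff_topologicalClosure_eq_top]
  refine hdense.mono ?_
  rintro _ ⟨f, hf, rfl⟩
  have hf' : f ∈ Submodule.span ℂ (Set.range hU.normalizedEntry) :=
    Submodule.span_le.mpr (fun g hg => hU.mem_span_normalizedEntry hg) hf
  have := Submodule.mem_map_of_mem (f := (ContinuousMap.toLp (p := 2) (E := ℂ) η ℂ).toLinearMap) hf'
  rw [Submodule.map_span, ← Set.range_comp] at this
  exact this

/-- **Plancherel formula** for continuous functions. -/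
theorem EnumeratesIURs.hasSum_plancherel (hU : EnumeratesIURs d U) {f : G → ℂ}
    (hf : Continuous f) :
    HasSum (fun r : Σ ℓ : I, Fin (d ℓ) × Fin (d ℓ) =>
        (d r.1 : ℝ) * ‖∫ A, f A * conj ((U r.1 A).1 r.2.1 r.2.2) ∂η‖ ^ 2)
      (∫ A, ‖f A‖ ^ 2 ∂η) := by
  let F : C(G, ℂ) := ⟨f, hf⟩
  let e := HilbertBasis.mk (hU.orthonormal η) (hU.span_dense η)
  have he : ∀ r, e r = ContinuousMap.toLp 2 η ℂ (hU.normalizedEntry r) := fun r =>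
    congrFun (HilbertBasis.coe_mk (hU.orthonormal η) (hU.span_dense η)) r
  have h := e.hasSum_inner_mul_inner (ContinuousMap.toLp 2 η ℂ F) (ContinuousMap.toLp 2 η ℂ F)
  have hre := Complex.hasSum_re h
  convert hre using 1
  · ext r
    rw [← inner_conj_symm, Complex.conj_mul', he, ContinuousMap.inner_toLp]
    have : ∫ A, F A * conj (hU.normalizedEntry r A) ∂η =
        (√(d r.1 : ℝ) : ℂ) * ∫ A, f A * conj ((U r.1 A).1 r.2.1 r.2.2) ∂η := by
      rw [← integral_const_mul]
      congr 1
      ext A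
      simp only [F, normalizedEntry, ContinuousMap.coe_mk, map_mul, Complex.conj_ofReal]
      ring
    rw [this, ← Complex.ofReal_pow, Complex.ofReal_re, norm_mul, mul_pow, Complex.norm_real,
      Real.norm_eq_abs, sq_abs, Real.sq_sqrt (Nat.cast_nonneg _)]
  · rw [ContinuousMap.inner_toLp]
    have : ∀ A, F A * conj (F A) = ((‖f A‖ ^ 2 : ℝ) : ℂ) := fun A => by
      rw [Complex.mul_conj']
      push_cast
      rfl
    simp only [this]
    exact (congrArg Complex.re (integral_ofReal (𝕜 := ℂ))).symm

end Orthogonality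

/-! ### The random walk and its Fourier coefficients -/

section Walk

variable {p : ℕ} {G : Subgroup (Matrix.unitaryGroup (Fin p) ℂ)} {N : ℕ}
  (x : Fin N → EuclideanSpace ℂ (Fin p)) (ε : ℝ)

theorem act_mul (A B : G) (y : EuclideanSpace ℂ (Fin p)) : act (A * B) y = act A (act B y) := by
  simp [act, Matrix.mulVec_mulVec]

theorem act_sub (A : G) (y z : EuclideanSpace ℂ (Fin p)) :
    act A (y - z) = act A y - act A z := by
  simp [act, Matrix.mulVec_sub]

theorem norm_act (A : G) (y : EuclideanSpace ℂ (Fin p)) : ‖act A y‖ = ‖y‖ := by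
  have hA : A.1.1ᴴ * A.1.1 = 1 := Matrix.mem_unitaryGroup_iff'.mp A.1.2
  have h : inner ℂ (act A y) (act A y) = inner ℂ y y := by
    simp only [act, EuclideanSpace.inner_eq_star_dotProduct]
    rw [Matrix.star_mulVec, dotProduct_comm, ← Matrix.dotProduct_mulVec, Matrix.mulVec_mulVec, hA,
      Matrix.one_mulVec, dotProduct_comm]
  rw [@norm_eq_sqrt_re_inner ℂ, h, ← @norm_eq_sqrt_re_inner ℂ]

theorem continuous_act (y : EuclideanSpace ℂ (Fin p)) : Continuous fun A : G => act A y := by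
  have h : Continuous fun A : G => A.1.1 :=
    continuous_subtype_val.comp continuous_subtype_val
  exact (PiLp.continuous_toLp 2 _).comp (h.matrix_mulVec continuous_const)

theorem kernelW_mul_left (i j : Fin N) (A B C : G) :
    kernelW x ε i j (A * B) (A * C) = kernelW x ε i j B C := by
  simp only [kernelW, act_mul, ← act_sub, norm_act]

theorem continuous_kernelW (i j : Fin N) :
    Continuous fun q : G × G => kernelW x ε i j q.1 q.2 := by
  have h1 : Continuous fun q : G × G => act q.1 (x i) := (continuous_act (x i)).comp continuous_fst
  have h2 : Continuous fun q : G × G => act q.2 (x j) := (continuous_act (x j)).comp continuous_snd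
  exact Real.continuous_exp.comp (((h1.sub h2).norm.pow 2).neg.div_const ε)

theorem continuous_kernelW_right (i j : Fin N) (A : G) :
    Continuous fun C : G => kernelW x ε i j A C :=
  (continuous_kernelW x ε i j).comp (f := fun C : G => (A, C)) (by fun_prop)

variable [MeasurableSpace G] (η : Measure G)

theorem stepKernel_succ {t : ℕ} (ht : 1 ≤ t) (i j : Fin N) (A B : G) :
    stepKernel η x ε (t + 1) i j A B =
      ∑ k, ∫ C, stepKernel η x ε t i k A C * kernelP η x ε k j C B ∂η := by
  obtain ⟨s, rfl⟩ := Nat.exists_eq_add_of_le' ht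
  rfl

theorem continuous_kernelP (i j : Fin N) :
    Continuous fun q : G × G => kernelP η x ε i j q.1 q.2 :=
  (continuous_kernelW x ε i j).div_const _

variable [CompactSpace G] [BorelSpace G] [η.IsHaarMeasure]

theorem degree_pos (i : Fin N) : 0 < degree η x ε i := by
  refine Finset.sum_pos (fun j _ => ?_) ⟨i, Finset.mem_univ i⟩
  have h := integrable_of_continuous η (continuous_kernelW_right x ε i j (1 : G))
  exact integral_exp_pos h

/-- Induction on `t`: integrating a jointly continuous function over the compact group leaves a
continuous function of the other variables. Later integrability and Fubini arguments for the step
densities rest on this. -/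
theorem continuous_stepKernel {t : ℕ} (ht : 1 ≤ t) (i j : Fin N) :
    Continuous fun q : G × G => stepKernel η x ε t i j q.1 q.2 := by
  induction t, ht using Nat.le_induction generalizing j with
  | base => exact continuous_kernelP x ε η i j
  | succ t ht ih =>
    simp only [stepKernel_succ x ε η ht]
    refine continuous_finsetSum _ fun k _ => ?_
    have h : Continuous (Function.uncurry fun (q : G × G) (C : G) =>
        stepKernel η x ε t i k q.1 C * kernelP η x ε k j C q.2) :=
      ((ih k).comp (f := fun q : (G × G) × G => (q.1.1, q.2)) (by fun_prop)).mul
        ((continuous_kernelP x ε η k j).comp (f := fun q : (G × G) × G => (q.2, q.1.2))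
          (by fun_prop))
    simpa using continuous_parametric_integral_of_continuous (μ := η) h isCompact_univ

theorem continuous_stepKernel_right {t : ℕ} (ht : 1 ≤ t) (i j : Fin N) (A : G) :
    Continuous fun C : G => stepKernel η x ε t i j A C :=
  (continuous_stepKernel x ε η ht i j).comp (Continuous.prodMk_right A)

theorem memLp_stepKernel {t : ℕ} (ht : 1 ≤ t) (i j : Fin N) (A : G) :
    MemLp (fun C : G => stepKernel η x ε t i j A C) 2 η :=
  (continuous_stepKernel_right x ε η ht i j A).memLp_of_hasCompactSupport
    (HasCompactSupport.of_compactSpace _)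

variable {n : ℕ} (U : G →* Matrix.unitaryGroup (Fin n) ℂ)

/-- The matrix `D⁻¹ Ŵ` of Fourier coefficients of the one-step transition density. -/
def transitionMatrix : Matrix (Fin N × Fin n) (Fin N × Fin n) ℂ :=
  (degreeMatrix η x ε n)⁻¹ * fourierMatrix η x ε U

/-- The Fourier coefficients of the `t`-step transition densities starting at `(i, A)`. -/
def stepCoeff (t : ℕ) (i : Fin N) (A : G) : Matrix (Fin n) (Fin N × Fin n) ℂ :=
  fun m r => ∫ C, (stepKernel η x ε t i r.1 A C : ℂ) * conj ((U C).1 m r.2) ∂η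

/-- The row of blocks which is `conj(U(A))` in position `i` and zero elsewhere. -/
def initialRow (N : ℕ) (i : Fin N) (A : G) : Matrix (Fin n) (Fin N × Fin n) ℂ :=
  fun m r => if r.1 = i then conj ((U A).1 m r.2) else 0

theorem transitionMatrix_apply (r s : Fin N × Fin n) :
    transitionMatrix x ε η U r s =
      (degree η x ε r.1 : ℂ)⁻¹ * ∫ C, (kernelW x ε r.1 s.1 (1 : G) C : ℂ) *
        conj ((U C).1 r.2 s.2) ∂η := by
  have hinv : (degreeMatrix η x ε n)⁻¹ =
      Matrix.diagonal fun r : Fin N × Fin n => (degree η x ε r.1 : ℂ)⁻¹ := by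
    refine Matrix.inv_eq_right_inv ?_
    rw [degreeMatrix, Matrix.diagonal_mul_diagonal, ← Matrix.diagonal_one]
    congr 1
    ext r
    exact mul_inv_cancel₀ (Complex.ofReal_ne_zero.mpr (degree_pos x ε η r.1).ne')
  rw [transitionMatrix, hinv, Matrix.diagonal_mul]
  rfl

variable {U}

/-- Substitute `A * C` for `C`: the kernel loses its dependence on `A`, and `U (A * C) = U A * U C`
moves that dependence into the factor `conj(U(A))`. -/
theorem integral_kernelP_mul_conj_entry (hU : Continuous U) (i : Fin N) (A : G) (m : Fin n)
    (s : Fin N × Fin n) :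
    ∫ C, (kernelP η x ε i s.1 A C : ℂ) * conj ((U C).1 m s.2) ∂η =
      ∑ b, conj ((U A).1 m b) * transitionMatrix x ε η U (i, b) s := by
  have hint : ∀ b, Integrable
      (fun C => (kernelW x ε i s.1 (1 : G) C : ℂ) * conj ((U C).1 b s.2)) η := fun b =>
    integrable_of_continuous η ((Complex.continuous_ofReal.comp
      (continuous_kernelW_right x ε i s.1 1)).mul
        (Complex.continuous_conj.comp (continuous_entry hU b s.2)))
  rw [← integral_mul_left_eq_self _ A]
  simp only [transitionMatrix_apply, ← integral_const_mul]
  rw [← integral_finsetSum _ fun b _ => ((hint b).const_mul _).const_mul _]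
  congr 1
  ext C
  have hW : kernelW x ε i s.1 A (A * C) = kernelW x ε i s.1 1 C := by
    simpa using kernelW_mul_left x ε i s.1 A 1 C
  rw [kernelP, hW, map_mul, Submonoid.coe_mul, Matrix.mul_apply, map_sum, Finset.mul_sum]
  refine Finset.sum_congr rfl fun b _ => ?_
  rw [map_mul]
  push_cast
  ring

theorem stepCoeff_one (hU : Continuous U) (i : Fin N) (A : G) :
    stepCoeff x ε η U 1 i A = initialRow U N i A * transitionMatrix x ε η U := by
  ext m s
  refine (integral_kernelP_mul_conj_entry x ε η hU i A m s).trans ?_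
  simp [Matrix.mul_apply, initialRow, Fintype.sum_prod_type, ite_mul, Finset.sum_ite_irrel]

/-- Convolution becomes a matrix product: by Fubini the endpoint `B` is integrated first, which
gives the one-step coefficient from the intermediate point `(k, C)`. -/
theorem stepCoeff_succ (hU : Continuous U) {t : ℕ} (ht : 1 ≤ t) (i : Fin N) (A : G) :
    stepCoeff x ε η U (t + 1) i A = stepCoeff x ε η U t i A * transitionMatrix x ε η U := by
  ext m s
  have hcont : ∀ k, Continuous (Function.uncurry fun B C : G =>
      (stepKernel η x ε t i k A C : ℂ) * ((kernelP η x ε k s.1 C B : ℂ) *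
        conj ((U B).1 m s.2))) := fun k =>
    (Complex.continuous_ofReal.comp ((continuous_stepKernel_right x ε η ht i k A).comp
      continuous_snd)).mul ((Complex.continuous_ofReal.comp
        ((continuous_kernelP x ε η k s.1).comp continuous_swap)).mul
          (Complex.continuous_conj.comp ((continuous_entry hU m s.2).comp continuous_fst)))
  have hcont' : ∀ k, Continuous fun B : G => ∫ C, (stepKernel η x ε t i k A C : ℂ) *
      ((kernelP η x ε k s.1 C B : ℂ) * conj ((U B).1 m s.2)) ∂η := fun k => by
    simpa using continuous_parametric_integral_of_continuous (μ := η) (hcont k) isCompact_univ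
  have hterm : ∀ k b, Integrable (fun C => (stepKernel η x ε t i k A C : ℂ) *
      conj ((U C).1 m b) * transitionMatrix x ε η U (k, b) s) η := fun k b =>
    integrable_of_continuous η (((Complex.continuous_ofReal.comp
      (continuous_stepKernel_right x ε η ht i k A)).mul
        (Complex.continuous_conj.comp (continuous_entry hU m b))).mul continuous_const)
  calc stepCoeff x ε η U (t + 1) i A m s
      = ∫ B, ∑ k, ∫ C, (stepKernel η x ε t i k A C : ℂ) *
          ((kernelP η x ε k s.1 C B : ℂ) * conj ((U B).1 m s.2)) ∂η ∂η := by
        rw [stepCoeff]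
        congr 1
        ext B
        rw [stepKernel_succ x ε η ht]
        push_cast
        rw [Finset.sum_mul]
        refine Finset.sum_congr rfl fun k _ => ?_
        rw [← integral_complex_ofReal, ← integral_mul_const]
        congr 1
        ext C
        push_cast
        ring
    _ = ∑ k, ∫ C, (stepKernel η x ε t i k A C : ℂ) *
          ∫ B, (kernelP η x ε k s.1 C B : ℂ) * conj ((U B).1 m s.2) ∂η ∂η := by
        rw [integral_finsetSum _ fun k _ => integrable_of_continuous η (hcont' k)]
        refine Finset.sum_congr rfl fun k _ => ?_
        rw [integral_integral_swap_of_hasCompactSupport (hcont k)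
          (HasCompactSupport.of_compactSpace _)]
        simp only [integral_const_mul]
    _ = ∑ k, ∑ b, stepCoeff x ε η U t i A m (k, b) * transitionMatrix x ε η U (k, b) s := by
        refine Finset.sum_congr rfl fun k _ => ?_
        simp only [integral_kernelP_mul_conj_entry x ε η hU, Finset.mul_sum, ← mul_assoc]
        rw [integral_finsetSum _ fun b _ => hterm k b]
        exact Finset.sum_congr rfl fun b _ => integral_mul_const _ _
    _ = _ := by rw [Matrix.mul_apply, Fintype.sum_prod_type]

theorem stepCoeff_eq (hU : Continuous U) {t : ℕ} (ht : 1 ≤ t) (i : Fin N) (A : G) :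
    stepCoeff x ε η U t i A = initialRow U N i A * transitionMatrix x ε η U ^ t := by
  induction t, ht using Nat.le_induction with
  | base => rw [pow_one, stepCoeff_one x ε η hU]
  | succ t ht ih => rw [stepCoeff_succ x ε η hU ht, ih, pow_succ, Matrix.mul_assoc]

end Walk

theorem hasSum_sigma_of_nonneg {ι : Type*} {κ : ι → Type*} [∀ i, Fintype (κ i)]
    {f : (Σ i, κ i) → ℝ} {S : ℝ} (hf : ∀ r, 0 ≤ f r)
    (h : HasSum (fun i => ∑ b, f ⟨i, b⟩) S) : HasSum f S := by
  have hfiber : ∀ i, HasSum (fun b => f ⟨i, b⟩) (∑ b, f ⟨i, b⟩) := fun i => hasSum_fintype _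
  have hsum : Summable f := (summable_sigma_of_nonneg hf).mpr
    ⟨fun i => (hfiber i).summable, by simpa only [(hfiber _).tsum_eq] using h.summable⟩
  exact (hsum.hasSum.sigma hfiber).unique h ▸ hsum.hasSum

/-! ### From Plancherel to eigenvector coordinates -/

section Isometry

variable {p : ℕ} {G : Subgroup (Matrix.unitaryGroup (Fin p) ℂ)} {N : ℕ}
  {x : Fin N → EuclideanSpace ℂ (Fin p)} {ε : ℝ} [MeasurableSpace G] {η : Measure G}

theorem IsNormalizedEigensystem.transitionMatrix_pow_mulVec {n : ℕ}
    {U : G →* Matrix.unitaryGroup (Fin n) ℂ} {μ : Fin (N * n) → ℂ}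
    {v : Fin (N * n) → Fin N × Fin n → ℂ} (hv : IsNormalizedEigensystem η x ε U μ v)
    (t : ℕ) (a : Fin (N * n)) :
    (transitionMatrix x ε η U ^ t) *ᵥ v a = (1 - μ a) ^ t • v a := by
  have h1 : transitionMatrix x ε η U *ᵥ v a = (1 - μ a) • v a := by
    have h := hv.eigen a
    rw [matrixK, Matrix.sub_mulVec, Matrix.one_mulVec] at h
    rw [sub_smul, one_smul, ← h, sub_sub_cancel, transitionMatrix]
  induction t with
  | zero => simp
  | succ t ih => rw [pow_succ, ← Matrix.mulVec_mulVec, h1, Matrix.mulVec_smul, ih, smul_smul,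
      pow_succ']

variable [CompactSpace G] [BorelSpace G] [η.IsHaarMeasure]

/-- Parseval's identity for a normalized eigensystem. -/
theorem IsNormalizedEigensystem.sum_norm_sq {n : ℕ}
    {U : G →* Matrix.unitaryGroup (Fin n) ℂ} {μ : Fin (N * n) → ℂ}
    {v : Fin (N * n) → Fin N × Fin n → ℂ} (hv : IsNormalizedEigensystem η x ε U μ v)
    (y : Fin N × Fin n → ℂ) :
    ∑ a, ‖∑ r, y r * v a r‖ ^ 2 = ∑ r, ‖y r‖ ^ 2 / degree η x ε r.1 := by
  -- There are exactly `N * n` orthonormal vectors, so they form a basis.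
  have hcard : Fintype.card (Fin (N * n)) =
      Module.finrank ℂ (EuclideanSpace ℂ (Fin N × Fin n)) := by simp
  have hspan := hv.orthonormal.linearIndependent.span_eq_top_of_card_eq_finrank' hcard
  let e := OrthonormalBasis.mk hv.orthonormal hspan.ge
  have hsqrt : ∀ i, (√(degree η x ε i) : ℂ) ≠ 0 := fun i =>
    Complex.ofReal_ne_zero.mpr (Real.sqrt_ne_zero'.mpr (degree_pos x ε η i))
  -- Pairing with `√D v` cancels the `√D`, and the conjugation is undone by the conjugate-linear
  -- slot, leaving `∑ y v`; the norm of `z` supplies the weights `1/D`.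
  let z : EuclideanSpace ℂ (Fin N × Fin n) :=
    WithLp.toLp 2 fun r => conj (y r) / (√(degree η x ε r.1) : ℂ)
  have h := e.sum_sq_norm_inner_left z
  rw [EuclideanSpace.norm_sq_eq] at h
  convert h using 1
  · refine Finset.sum_congr rfl fun a _ => ?_
    congr 2
    simp only [e, z, OrthonormalBasis.coe_mk, PiLp.inner_apply, RCLike.inner_apply, map_div₀,
      Complex.conj_conj, Complex.conj_ofReal]
    refine Finset.sum_congr rfl fun r _ => ?_
    field_simp [hsqrt r.1]
  · refine Finset.sum_congr rfl fun r _ => ?_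
    simp only [z, norm_div, RCLike.norm_conj, div_pow, Complex.norm_real, Real.norm_eq_abs, sq_abs,
      Real.sq_sqrt (degree_pos x ε η r.1).le]

variable {I : Type*} {d : I → ℕ} {U : ∀ ℓ : I, G →* Matrix.unitaryGroup (Fin (d ℓ)) ℂ}
  {lamTilde : ∀ ℓ : I, Fin (N * d ℓ) → ℂ}
  {vTilde : ∀ ℓ : I, Fin (N * d ℓ) → Fin N × Fin (d ℓ) → ℂ}

/-- The eigenvalue power is absorbed by `T^t ṽ = λ^t ṽ`. The coordinate then becomes linear in the
`t`-step density, as Plancherel requires. -/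
theorem diffusionMap_eq (hU : EnumeratesIURs d U)
    (hv : ∀ ℓ : I, IsNormalizedEigensystem η x ε (U ℓ) (lamTilde ℓ) (vTilde ℓ))
    {t : ℕ} (ht : 1 ≤ t) (i : Fin N) (A : G) (r : MapIndex N d) :
    diffusionMap U lamTilde vTilde t i A r =
      (√(d r.1 : ℝ) : ℂ) *
        (stepCoeff x ε η (U r.1) t i A *ᵥ vTilde r.1 r.2.1) r.2.2 := by
  rw [stepCoeff_eq x ε η (hU.isIUR r.1).continuous ht, ← Matrix.mulVec_mulVec,
    (hv r.1).transitionMatrix_pow_mulVec, Matrix.mulVec_smul, Pi.smul_apply, smul_eq_mul,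
    diffusionMap]
  have : (((U r.1 A).1.map conj) *ᵥ block i (vTilde r.1 r.2.1)) r.2.2 =
      (initialRow (U r.1) N i A *ᵥ vTilde r.1 r.2.1) r.2.2 := by
    simp [Matrix.mulVec, dotProduct, initialRow, block, Fintype.sum_prod_type,
      Finset.sum_ite_irrel]
  rw [this]
  ring

variable [IsProbabilityMeasure η]

/-- Plancherel's formula in the coordinates given by normalized eigensystems. -/
theorem hasSum_weightedNormSq (hU : EnumeratesIURs d U)
    (hv : ∀ ℓ : I, IsNormalizedEigensystem η x ε (U ℓ) (lamTilde ℓ) (vTilde ℓ))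
    {f : Fin N → G → ℝ} (hf : ∀ k, Continuous (f k)) {g : MapIndex N d → ℂ}
    (hg : ∀ r, g r = (√(d r.1 : ℝ) : ℂ) * ∑ s : Fin N × Fin (d r.1),
      (∫ C, (f s.1 C : ℂ) * conj ((U r.1 C).1 r.2.2 s.2) ∂η) * vTilde r.1 r.2.1 s) :
    HasSum (fun r => ‖g r‖ ^ 2) (weightedNormSq η x ε f) := by
  have hk : ∀ k, HasSum (fun ℓ => ∑ r : Fin (d ℓ) × Fin (d ℓ),
      (d ℓ : ℝ) * ‖∫ C, (f k C : ℂ) * conj ((U ℓ C).1 r.1 r.2) ∂η‖ ^ 2 / degree η x ε k)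
      (∫ C, f k C ^ 2 / degree η x ε k ∂η) := fun k => by
    have h := ((hU.hasSum_plancherel η (Complex.continuous_ofReal.comp (hf k))).div_const
      (degree η x ε k)).sigma fun ℓ => hasSum_fintype _
    rw [← integral_div] at h
    simpa only [Function.comp_apply, Complex.norm_real, Real.norm_eq_abs, sq_abs] using h
  have hsum := hasSum_sum (s := Finset.univ) fun k _ => hk k
  refine hasSum_sigma_of_nonneg (fun _ => by positivity) ?_
  refine (congrArg (HasSum · _) (funext fun ℓ => ?_)).mpr hsum
  simp only [hg, norm_mul, mul_pow, Complex.norm_real, Real.norm_eq_abs, sq_abs,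
    Real.sq_sqrt (Nat.cast_nonneg (d ℓ)), ← Finset.mul_sum, mul_div_assoc]
  congr 1
  -- For each fixed row `m`, the sum over the eigenvectors is evaluated by Parseval.
  rw [Fintype.sum_prod_type_right]
  refine (Finset.sum_congr rfl fun m _ => (hv ℓ).sum_norm_sq
    fun s => ∫ C, (f s.1 C : ℂ) * conj ((U ℓ C).1 m s.2) ∂η).trans ?_
  simp only [Fintype.sum_prod_type]
  rw [Finset.sum_comm]

end Isometry

end GDiffusion

end

/-! ### The diffusion distance identity -/

theorem mainTheorem2 {p N : ℕ} (G : Subgroup (Matrix.unitaryGroup (Fin p) ℂ))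
    (hG : IsClosed (G : Set (Matrix.unitaryGroup (Fin p) ℂ)))
    [MeasurableSpace G] [BorelSpace G]
    (η : MeasureTheory.Measure G) [η.IsHaarMeasure] [MeasureTheory.IsProbabilityMeasure η]
    (x : Fin N → EuclideanSpace ℂ (Fin p)) (ε : ℝ) (hε : 0 < ε)
    {I : Type*} (d : I → ℕ) (U : ∀ ℓ : I, G →* Matrix.unitaryGroup (Fin (d ℓ)) ℂ)
    (hU : GDiffusion.EnumeratesIURs d U)
    (lamTilde : ∀ ℓ : I, Fin (N * d ℓ) → ℂ)
    (vTilde : ∀ ℓ : I, Fin (N * d ℓ) → Fin N × Fin (d ℓ) → ℂ)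
    (hv : ∀ ℓ : I,
      GDiffusion.IsNormalizedEigensystem η x ε (U ℓ) (lamTilde ℓ) (vTilde ℓ))
    (t : ℕ) (ht : 1 ≤ t) (i j : Fin N) (A B : G) :
    (∀ k : Fin N,
      MeasureTheory.MemLp (fun C : G => GDiffusion.stepKernel η x ε t i k A C) 2 η ∧
      MeasureTheory.MemLp (fun C : G => GDiffusion.stepKernel η x ε t j k B C) 2 η) ∧
    ∃ (hA : Memℓp (GDiffusion.diffusionMap U lamTilde vTilde t i A) 2)
      (hB : Memℓp (GDiffusion.diffusionMap U lamTilde vTilde t j B) 2),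
      GDiffusion.weightedNormSq η x ε
          (fun k C => GDiffusion.stepKernel η x ε t i k A C - GDiffusion.stepKernel η x ε t j k B C) =
        ‖(⟨GDiffusion.diffusionMap U lamTilde vTilde t i A, hA⟩ :
            lp (fun _ : GDiffusion.MapIndex N d => ℂ) 2) -
          ⟨GDiffusion.diffusionMap U lamTilde vTilde t j B, hB⟩‖ ^ 2 := by
  open GDiffusion in
  have : CompactSpace G := compactSpace_of_isClosed hG
  have hcont : ∀ i A k, Continuous fun C => stepKernel η x ε t i k A C := fun i A k =>
    continuous_stepKernel_right x ε η ht i k A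
  -- Applied to a single density, the coordinate Plancherel formula already gives
  -- square-summability.
  have hmem : ∀ i A, Memℓp (diffusionMap U lamTilde vTilde t i A) 2 := fun i A => by
    refine memℓp_gen ?_
    simpa using (hasSum_weightedNormSq hU hv (hcont i A)
      (diffusionMap_eq hU hv ht i A)).summable
  refine ⟨fun k => ⟨memLp_stepKernel x ε η ht i k A, memLp_stepKernel x ε η ht j k B⟩,
    hmem i A, hmem j B, ?_⟩
  have hint : ∀ i A k ℓ (a b : Fin (d ℓ)), MeasureTheory.Integrable (fun C =>
      (stepKernel η x ε t i k A C : ℂ) * starRingEnd ℂ ((U ℓ C).1 a b)) η :=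
    fun i A k ℓ a b => integrable_of_continuous η
      ((Complex.continuous_ofReal.comp (hcont i A k)).mul
        (Complex.continuous_conj.comp (continuous_entry (hU.isIUR ℓ).continuous a b)))
  have hsum := hasSum_weightedNormSq hU hv
    (f := fun k C => stepKernel η x ε t i k A C - stepKernel η x ε t j k B C)
    (fun k => (hcont i A k).sub (hcont j B k))
    (g := fun r => diffusionMap U lamTilde vTilde t i A r - diffusionMap U lamTilde vTilde t j B r)
    (fun r => by
      rw [diffusionMap_eq hU hv ht, diffusionMap_eq hU hv ht, ← mul_sub]
      congr 1
      simp only [Matrix.mulVec, dotProduct, ← Finset.sum_sub_distrib, ← sub_mul, stepCoeff]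
      refine Finset.sum_congr rfl fun s _ => ?_
      rw [← MeasureTheory.integral_sub (hint i A _ _ _ _) (hint j B _ _ _ _)]
      simp only [Complex.ofReal_sub, sub_mul])
  rw [← hsum.tsum_eq]
  have := lp.norm_rpow_eq_tsum (p := 2) (by simp)
    ((⟨diffusionMap U lamTilde vTilde t i A, hmem i A⟩ :
      lp (fun _ : MapIndex N d => ℂ) 2) - ⟨diffusionMap U lamTilde vTilde t j B, hmem j B⟩)
  simp only [ENNReal.toReal_ofNat, Real.rpow_ofNat] at this
  exact this.symm
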